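/- The monadic theory of $(\omega,<)$ is decidable. That is, consider the monadic second-order language of order, whose formulas are built from the atomic formulas $x<y$, $x=y$ and $X(x)$ ($x,y$ individual variables, $X$ a set variable) with the Boolean connectives, quantifiers over individual variables, and quantifiers over set variables. Then there is an algorithm which, given (the Gödel number of) a formula of this language, decides whether it is a sentence that is true in $(\omega,<)$, where individual variables range over $\omega$ and set variables range over all subsets of $\omega$. -/

import Mathlib

/-- Formulas of the monadic second-order language of order. Individual variables `x_i` and set
variables `X_k` are both indexed by natural numbers; the atomic formulas are `x_i < x_j`,
`x_i = x_j` and `X_k(x_i)`. The other connectives and the universal quantifiers are the usual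
abbreviations. -/
inductive MonFormula : Type
  | lt (i j : ℕ)
  | eq (i j : ℕ)
  | mem (i k : ℕ)
  | neg (φ : MonFormula)
  | and (φ ψ : MonFormula)
  | exInd (i : ℕ) (φ : MonFormula)
  | exSet (k : ℕ) (φ : MonFormula)

namespace MonFormula

/-- The indices of the free individual variables. -/
def freeInd : MonFormula → Finset ℕ
  | lt i j => {i, j}
  | eq i j => {i, j}
  | mem i _ => {i}
  | neg φ => φ.freeInd
  | and φ ψ => φ.freeInd ∪ ψ.freeInd
  | exInd i φ => φ.freeInd.erase i
  | exSet _ φ => φ.freeInd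

/-- The indices of the free set variables. -/
def freeSet : MonFormula → Finset ℕ
  | lt _ _ => ∅
  | eq _ _ => ∅
  | mem _ k => {k}
  | neg φ => φ.freeSet
  | and φ ψ => φ.freeSet ∪ ψ.freeSet
  | exInd _ φ => φ.freeSet
  | exSet k φ => φ.freeSet.erase k

/-- A sentence is a formula without free variables of either kind. -/
def IsSentence (φ : MonFormula) : Prop := φ.freeInd = ∅ ∧ φ.freeSet = ∅

/-- Satisfaction in `(M, <)` under the assignment `v` of elements to the individual variables and
`V` of subsets to the set variables. The set quantifier ranges over all subsets of `M`. -/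
def Sat (M : Type*) [LT M] : MonFormula → (ℕ → M) → (ℕ → Set M) → Prop
  | lt i j, v, _ => v i < v j
  | eq i j, v, _ => v i = v j
  | mem i k, v, V => v i ∈ V k
  | neg φ, v, V => ¬ φ.Sat M v V
  | and φ ψ, v, V => φ.Sat M v V ∧ ψ.Sat M v V
  | exInd i φ, v, V => ∃ a : M, φ.Sat M (Function.update v i a) V
  | exSet k φ, v, V => ∃ P : Set M, φ.Sat M v (Function.update V k P)

/-- The Gödel number of a formula. -/
def code : MonFormula → ℕ
  | lt i j => 7 * Nat.pair i j
  | eq i j => 7 * Nat.pair i j + 1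
  | mem i k => 7 * Nat.pair i k + 2
  | neg φ => 7 * φ.code + 3
  | and φ ψ => 7 * Nat.pair φ.code ψ.code + 4
  | exInd i φ => 7 * Nat.pair i φ.code + 5
  | exSet k φ => 7 * Nat.pair k φ.code + 6

theorem code_injective : Function.Injective code := by
  intro φ
  induction φ with
  | lt | eq | mem =>
    intro ψ h
    cases ψ <;> simp only [code] at h <;> first | omega | skip
    simpa [Nat.pair_eq_pair] using h
  | neg φ ih =>
    intro ψ h
    cases ψ <;> simp only [code] at h <;> first | omega | skip
    simp at h
    rw [ih h]
  | and φ χ ih₁ ih₂ =>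
    intro ψ h
    cases ψ <;> simp only [code] at h <;> first | omega | skip
    simp [Nat.pair_eq_pair] at h
    rw [ih₁ h.1, ih₂ h.2]
  | exInd i φ ih | exSet i φ ih =>
    intro ψ h
    cases ψ <;> simp only [code] at h <;> first | omega | skip
    simp [Nat.pair_eq_pair] at h
    rw [h.1, ih h.2]

theorem code_surjective : Function.Surjective code := by
  intro n
  induction n using Nat.strong_induction_on with
  | _ n ih =>
    have hd := Nat.div_add_mod n 7
    have hm : n % 7 < 7 := Nat.mod_lt _ (by norm_num)
    have hp := Nat.pair_unpair (n / 7)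
    have hl := Nat.unpair_left_le (n / 7)
    have hr := Nat.unpair_right_le (n / 7)
    generalize (n / 7).unpair.1 = a at hp hl
    generalize (n / 7).unpair.2 = b at hp hr
    generalize n % 7 = r at hd hm
    interval_cases r
    · exact ⟨lt a b, by simp only [code]; omega⟩
    · exact ⟨eq a b, by simp only [code]; omega⟩
    · exact ⟨mem a b, by simp only [code]; omega⟩
    · obtain ⟨φ, hφ⟩ := ih (n / 7) (by omega)
      exact ⟨neg φ, by simp only [code]; omega⟩
    · obtain ⟨φ, hφ⟩ := ih a (by omega)
      obtain ⟨ψ, hψ⟩ := ih b (by omega)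
      exact ⟨and φ ψ, by simp only [code, hφ, hψ]; omega⟩
    · obtain ⟨φ, hφ⟩ := ih b (by omega)
      exact ⟨exInd a φ, by simp only [code, hφ]; omega⟩
    · obtain ⟨φ, hφ⟩ := ih b (by omega)
      exact ⟨exSet a φ, by simp only [code, hφ]; omega⟩

/-- Formulas are presented to algorithms through their Gödel numbers. -/
noncomputable instance : Primcodable MonFormula :=
  Primcodable.ofEquiv ℕ (Equiv.ofBijective code ⟨code_injective, code_surjective⟩)

theorem encode_eq_code (φ : MonFormula) : Encodable.encode φ = φ.code := rfl

end MonFormula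

/-- The monadic theory of the (nonempty) order `(M, <)`: the set of all monadic sentences true in
it. The truth value of a sentence does not depend on the assignments. -/
def monadicTheory (M : Type*) [LT M] [Nonempty M] : Set MonFormula :=
  {φ | φ.IsSentence ∧ ∀ (v : ℕ → M) (V : ℕ → Set M), φ.Sat M v V}

/-! ### Primitive recursive building blocks -/

/-! Variables are turned into sets, an individual variable being a set restricted to singletons, so
that a formula defines a language of ω-words over the letters below `2 ^ K`. By induction on the
formula this language is recognized by a finite algebra: every nonempty segment of a word has a
value in the algebra, values multiply under concatenation, and membership is read off from a linked
pair `(s, e)`, with `e * e = e` and `s * e = s`, such that the word factors into a segment of value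
`s` followed by segments of value `e`. Ramsey's theorem (`exists_strictMono_homogeneous`, used
through `IsValuation.exists_linked`) supplies such a factorization for every word.

The criterion `Recognizes` demands the right answer from every linked factorization. Hence
complementation only negates the acceptance table, with no determinization, and conjunction is a
product. The essential case is the set quantifier (`Recognizes.proj`), handled by the power set
algebra: Ramsey's theorem regroups the factorization of a word expanded by a witness, and conversely
witnesses chosen segment by segment are glued together.

All tables are primitive recursive in the code of the formula. For a sentence it remains to test one
word, that with all sets empty. It repeats a single letter, so any linked pair of powers of that
letter describes a factorization of it (`Recognizes.empty_iff`). One exists by Ramsey's theorem, so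
it can be found by search. -/

/-- The number whose binary digits below `n` are given by `p`, the others being zero. -/
def bitmask (n : ℕ) (p : ℕ → Bool) : ℕ :=
  Nat.rec 0 (fun i s => s + if p i then 2 ^ i else 0) n

theorem bitmask_succ (n : ℕ) (p : ℕ → Bool) :
    bitmask (n + 1) p = bitmask n p + if p n then 2 ^ n else 0 := rfl

theorem bitmask_lt (n : ℕ) (p : ℕ → Bool) : bitmask n p < 2 ^ n := by
  induction n with
  | zero => simp [bitmask]
  | succ n ih =>
    rw [bitmask_succ, pow_succ]
    split_ifs <;> omega

theorem bitmask_congr {n : ℕ} {p q : ℕ → Bool} (h : ∀ i < n, p i = q i) :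
    bitmask n p = bitmask n q := by
  induction n with
  | zero => rfl
  | succ n ih => rw [bitmask_succ, bitmask_succ, ih fun i hi => h i (by omega), h n (by omega)]

theorem testBit_bitmask (n : ℕ) (p : ℕ → Bool) (i : ℕ) :
    (bitmask n p).testBit i = (decide (i < n) && p i) := by
  induction n with
  | zero => simp [bitmask]
  | succ n ih =>
    rw [bitmask_succ]
    rcases lt_trichotomy i n with h | rfl | h
    · have h' : i < n + 1 := by omega
      split_ifs
      · rw [add_comm, Nat.testBit_two_pow_add_gt h, ih]; simp [h, h']
      · rw [add_zero, ih]; simp [h, h']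
    · have := Nat.testBit_eq_false_of_lt (bitmask_lt i p)
      split_ifs with hp
      · rw [add_comm, Nat.testBit_two_pow_add_eq, this]; simp [hp]
      · rw [add_zero, this]; simp [hp]
    · have h' : ¬ i < n + 1 := by omega
      have hlt := bitmask_lt (n + 1) p
      rw [bitmask_succ] at hlt
      rw [Nat.testBit_eq_false_of_lt (hlt.trans_le (Nat.pow_le_pow_right two_pos (by omega)))]
      simp [h']

theorem testBit_bitmask_of_lt {n i : ℕ} (p : ℕ → Bool) (h : i < n) :
    (bitmask n p).testBit i = p i := by
  simp [testBit_bitmask, h]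

/-! ### Finite tables and their computability -/

/-- The list of the values of `f` below `n`. -/
def tabulate {σ : Type*} (n : ℕ) (f : ℕ → σ) : List σ := (List.range n).map f

/-- A list holding the values of `f` at all pairs of numbers below `n`. -/
def tabulate₂ {σ : Type*} (n : ℕ) (f : ℕ → ℕ → σ) : List σ :=
  tabulate ((n + n + 1) ^ 2) fun i => f i.unpair.1 i.unpair.2

theorem getD_tabulate {σ : Type*} {n i : ℕ} (f : ℕ → σ) (d : σ) (h : i < n) :
    (tabulate n f).getD i d = f i := by
  simp [tabulate, h]

/-- The bound serves twice: for the length of two-argument tables and for the number of elements of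
a product algebra. -/
theorem pair_lt_sq {m n x y : ℕ} (hx : x < m) (hy : y < n) : Nat.pair x y < (m + n + 1) ^ 2 := by
  refine (Nat.pair_lt_max_add_one_sq x y).trans_le (Nat.pow_le_pow_left ?_ 2)
  have : max x y ≤ m + n := max_le (by omega) (by omega)
  omega

theorem getD_tabulate₂ {σ : Type*} {n x y : ℕ} (f : ℕ → ℕ → σ) (d : σ) (hx : x < n) (hy : y < n) :
    (tabulate₂ n f).getD (Nat.pair x y) d = f x y := by
  rw [tabulate₂, getD_tabulate _ _ (pair_lt_sq hx hy), Nat.unpair_pair]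

section Primrec

variable {α σ : Type*} [Primcodable α] [Primcodable σ]

theorem primrec₂_pow : Primrec₂ ((· ^ ·) : ℕ → ℕ → ℕ) :=
  Primrec₂.unpaired'.1 Nat.Primrec.pow

theorem primrec₂_testBit : Primrec₂ Nat.testBit :=
  ((Primrec.eq.comp₂ (Primrec.nat_mod.comp₂
    (Primrec.nat_div.comp₂ Primrec₂.left (primrec₂_pow.comp₂ (Primrec₂.const 2) Primrec₂.right))
    (Primrec₂.const 2)) (Primrec₂.const 1)).decide).of_eq
    fun _ _ => Nat.testBit_eq_decide_div_mod_eq.symm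

theorem primrec_bitmask {n : α → ℕ} {p : α → ℕ → Bool} (hn : Primrec n) (hp : Primrec₂ p) :
    Primrec fun a => bitmask (n a) (p a) := by
  refine Primrec.nat_rec' hn (Primrec.const 0)
    (h := fun a q => q.2 + if p a q.1 then 2 ^ q.1 else 0) ?_
  refine Primrec.nat_add.comp₂ (Primrec.snd.comp₂ Primrec₂.right) (Primrec.ite ?_ ?_ (Primrec.const 0))
  · exact Primrec.eq.comp (hp.comp Primrec.fst (Primrec.fst.comp Primrec.snd)) (Primrec.const true)
  · exact primrec₂_pow.comp (Primrec.const 2) (Primrec.fst.comp Primrec.snd)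

theorem primrec_tabulate {n : α → ℕ} {f : α → ℕ → σ} (hn : Primrec n) (hf : Primrec₂ f) :
    Primrec fun a => tabulate (n a) (f a) :=
  Primrec.list_map (Primrec.list_range.comp hn) hf

theorem primrec_tabulate₂ {n : α → ℕ} {f : α → ℕ → ℕ → σ} (hn : Primrec n)
    (hf : Primrec fun p : α × ℕ × ℕ => f p.1 p.2.1 p.2.2) :
    Primrec fun a => tabulate₂ (n a) (f a) := by
  refine primrec_tabulate ?_ ?_
  · exact primrec₂_pow.comp (Primrec.succ.comp (Primrec.nat_add.comp hn hn)) (Primrec.const 2)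
  · exact hf.comp (Primrec.pair Primrec.fst (Primrec.unpair.comp Primrec.snd))

theorem PrimrecPred.exists_lt_of {n : α → ℕ} {P : α → ℕ → Prop} (hn : Primrec n)
    (hP : PrimrecPred fun p : α × ℕ => P p.1 p.2) : PrimrecPred fun a => ∃ x < n a, P a x := by
  have h : PrimrecRel fun (x : ℕ) (a : α) => P a x :=
    hP.comp (Primrec.pair Primrec.snd Primrec.fst)
  exact (h.exists_mem_list.comp (Primrec.list_range.comp hn) Primrec.id).of_eq (by simp)

end Primrec

/-! ### Primitive recursion along formulas -/

namespace MonFormula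

/-- A function defined by structural recursion on formulas, with a parameter that stays fixed, is
primitive recursive when the functions used at each clause are. -/
theorem primrec₂_of_rec {α σ : Type*} [Primcodable α] [Primcodable σ] {F : α → MonFormula → σ}
    {flt feq fmem : α → ℕ → ℕ → σ} {fneg : α → σ → σ} {fand : α → σ → σ → σ}
    {fexInd fexSet : α → ℕ → σ → σ}
    (hlt : Primrec fun p : α × ℕ × ℕ => flt p.1 p.2.1 p.2.2)
    (heq : Primrec fun p : α × ℕ × ℕ => feq p.1 p.2.1 p.2.2)
    (hmem : Primrec fun p : α × ℕ × ℕ => fmem p.1 p.2.1 p.2.2)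
    (hneg : Primrec fun p : α × σ => fneg p.1 p.2)
    (hand : Primrec fun p : α × σ × σ => fand p.1 p.2.1 p.2.2)
    (hexInd : Primrec fun p : α × ℕ × σ => fexInd p.1 p.2.1 p.2.2)
    (hexSet : Primrec fun p : α × ℕ × σ => fexSet p.1 p.2.1 p.2.2)
    (Flt : ∀ a i j, F a (lt i j) = flt a i j)
    (Feq : ∀ a i j, F a (eq i j) = feq a i j)
    (Fmem : ∀ a i k, F a (mem i k) = fmem a i k)
    (Fneg : ∀ a φ, F a (neg φ) = fneg a (F a φ))
    (Fand : ∀ a φ ψ, F a (and φ ψ) = fand a (F a φ) (F a ψ))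
    (FexInd : ∀ a i φ, F a (exInd i φ) = fexInd a i (F a φ))
    (FexSet : ∀ a k φ, F a (exSet k φ) = fexSet a k (F a φ)) : Primrec₂ F := by
  let e : MonFormula ≃ ℕ := Equiv.ofBijective code ⟨code_injective, code_surjective⟩
  have he : ∀ φ, e.symm (code φ) = φ := e.symm_apply_apply
  suffices h : Primrec₂ fun a n => F a (e.symm n) from
    (h.comp Primrec.fst (Primrec.encode.comp Primrec.snd)).of_eq
      fun p => congrArg (F p.1) (he p.2)
  -- For strong recursion on codes, `l` lists the values at all smaller codes. Its length is
  -- therefore the current code, from which the clause `r l` and its arguments are decoded.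
  let q : List σ → ℕ := fun l => l.length / 7
  let u : List σ → ℕ × ℕ := fun l => (q l).unpair
  let r : List σ → ℕ := fun l => l.length % 7
  have hq : Primrec q := Primrec.nat_div.comp Primrec.list_length (Primrec.const 7)
  have hu : Primrec u := Primrec.unpair.comp hq
  have hr : Primrec r := Primrec.nat_mod.comp Primrec.list_length (Primrec.const 7)
  let g : α → List σ → Option σ := fun a l =>
    if r l = 0 then some (flt a (u l).1 (u l).2)
    else if r l = 1 then some (feq a (u l).1 (u l).2)
    else if r l = 2 then some (fmem a (u l).1 (u l).2)
    else if r l = 3 then l[q l]?.map (fneg a)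
    else if r l = 4 then l[(u l).1]?.bind fun x => l[(u l).2]?.map (fand a x)
    else if r l = 5 then l[(u l).2]?.map (fexInd a (u l).1)
    else l[(u l).2]?.map (fexSet a (u l).1)
  have hc : ∀ c, PrimrecPred fun p : α × List σ => r p.2 = c := fun c =>
    Primrec.eq.comp (hr.comp Primrec.snd) (Primrec.const c)
  have hau : Primrec fun p : α × List σ => (p.1, u p.2) :=
    Primrec.pair Primrec.fst (hu.comp Primrec.snd)
  have hu1 : Primrec fun p : α × List σ => (u p.2).1 := Primrec.fst.comp (hu.comp Primrec.snd)
  have hu2 : Primrec fun p : α × List σ => (u p.2).2 := Primrec.snd.comp (hu.comp Primrec.snd)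
  have hg : Primrec₂ g := by
    refine Primrec.ite (hc 0) (Primrec.option_some.comp (hlt.comp hau)) ?_
    refine Primrec.ite (hc 1) (Primrec.option_some.comp (heq.comp hau)) ?_
    refine Primrec.ite (hc 2) (Primrec.option_some.comp (hmem.comp hau)) ?_
    refine Primrec.ite (hc 3) (Primrec.option_map
      (Primrec.list_getElem?.comp Primrec.snd (hq.comp Primrec.snd))
      (hneg.comp (Primrec.pair (Primrec.fst.comp Primrec.fst) Primrec.snd))) ?_
    refine Primrec.ite (hc 4) (Primrec.option_bind
      (Primrec.list_getElem?.comp Primrec.snd hu1) (Primrec.option_map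
        (Primrec.list_getElem?.comp (Primrec.snd.comp Primrec.fst) (hu2.comp Primrec.fst))
        (hand.comp (Primrec.pair (Primrec.fst.comp (Primrec.fst.comp Primrec.fst))
          (Primrec.pair (Primrec.snd.comp Primrec.fst) Primrec.snd))))) ?_
    refine Primrec.ite (hc 5) (Primrec.option_map
      (Primrec.list_getElem?.comp Primrec.snd hu2)
      (hexInd.comp (Primrec.pair (Primrec.fst.comp Primrec.fst)
        (Primrec.pair (hu1.comp Primrec.fst) Primrec.snd)))) ?_
    exact Primrec.option_map
      (Primrec.list_getElem?.comp Primrec.snd hu2)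
      (hexSet.comp (Primrec.pair (Primrec.fst.comp Primrec.fst)
        (Primrec.pair (hu1.comp Primrec.fst) Primrec.snd)))
  refine Primrec.nat_strong_rec _ hg fun a n => ?_
  obtain ⟨φ, rfl⟩ := code_surjective n
  rw [he]
  have hget : ∀ ψ : MonFormula, ψ.code < φ.code →
      ((List.range φ.code).map fun n => F a (e.symm n))[ψ.code]? = some (F a ψ) := fun ψ h => by
    simp [h, he]
  generalize hl : ((List.range φ.code).map fun n => F a (e.symm n)) = l at hget ⊢
  have hlen : l.length = φ.code := by simp [← hl]
  have hql : q l = φ.code / 7 := by simp only [q, hlen]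
  have hrl : r l = φ.code % 7 := by simp only [r, hlen]
  simp only [g, u, hql, hrl]
  cases φ with
  | lt i j => simp [code, Flt]
  | eq i j =>
    have h : (7 * Nat.pair i j + 1) / 7 = Nat.pair i j := by omega
    simp [code, Feq, h, Nat.add_mod]
  | mem i k =>
    have h : (7 * Nat.pair i k + 2) / 7 = Nat.pair i k := by omega
    simp [code, Fmem, h, Nat.add_mod]
  | neg φ =>
    have h : (7 * φ.code + 3) / 7 = φ.code := by omega
    have := hget φ (by simp only [code]; omega)
    simp [code, Fneg, h, Nat.add_mod, this]
  | and φ ψ =>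
    have h : (7 * Nat.pair φ.code ψ.code + 4) / 7 = Nat.pair φ.code ψ.code := by omega
    have h₁ := hget φ (by have := Nat.left_le_pair φ.code ψ.code; simp only [code]; omega)
    have h₂ := hget ψ (by have := Nat.right_le_pair φ.code ψ.code; simp only [code]; omega)
    simp [code, Fand, h, Nat.add_mod, h₁, h₂]
  | exInd i φ =>
    have h : (7 * Nat.pair i φ.code + 5) / 7 = Nat.pair i φ.code := by omega
    have := hget φ (by have := Nat.right_le_pair i φ.code; simp only [code]; omega)
    simp [code, FexInd, h, Nat.add_mod, this]
  | exSet k φ =>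
    have h : (7 * Nat.pair k φ.code + 6) / 7 = Nat.pair k φ.code := by omega
    have := hget φ (by have := Nat.right_le_pair k φ.code; simp only [code]; omega)
    simp [code, FexSet, h, Nat.add_mod, this]

end MonFormula

/-! ### Ramsey's theorem for pairs -/

section Ramsey

open Filter

/-- An ultrafilter containing a finite union contains one of its members. -/
theorem eventually_hyperfilter_eq {f : ℕ → ℕ} {m : ℕ} (h : ∀ᶠ i in hyperfilter ℕ, f i < m) :
    ∃ e, ∀ᶠ i in hyperfilter ℕ, f i = e := by
  have h' : (⋃ e ∈ Set.Iio m, {i | f i = e}) ∈ hyperfilter ℕ := by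
    filter_upwards [h] with i hi
    simpa using hi
  obtain ⟨e, -, he⟩ := (Ultrafilter.finite_biUnion_mem_iff (Set.finite_Iio m)).1 h'
  exact ⟨e, he⟩

/-- Ramsey's theorem for colorings of pairs of natural numbers with finitely many colors. -/
theorem exists_strictMono_homogeneous (c : ℕ → ℕ → ℕ) (m : ℕ) (hc : ∀ i j, i < j → c i j < m) :
    ∃ e, ∃ g : ℕ → ℕ, StrictMono g ∧ ∀ i j, i < j → c (g i) (g j) = e := by
  have hgt : ∀ i, ∀ᶠ j in hyperfilter ℕ, i < j := fun i =>
    (eventually_gt_atTop i).filter_mono Nat.hyperfilter_le_atTop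
  -- `d i` is the color of `(i, j)` for almost all `j` in the sense of the ultrafilter.
  choose d hd using fun i =>
    eventually_hyperfilter_eq (f := c i) ((hgt i).mono fun j hj => hc i j hj)
  have hdm : ∀ i, d i < m := fun i => by
    obtain ⟨j, h₁, h₂⟩ := ((hd i).and (hgt i)).exists
    exact h₁ ▸ hc i j h₂
  obtain ⟨e, he⟩ := eventually_hyperfilter_eq (f := d) (.of_forall hdm)
  -- The sequence is chosen greedily among the `i` with `d i = e`: finitely many earlier choices
  -- exclude only a set outside the ultrafilter.
  obtain ⟨g, -, hg⟩ := exists_seq_of_forall_finset_exists (fun i => d i = e)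
    (fun i j => i < j ∧ c i j = e) fun s hs => by
      have : ∀ᶠ j in hyperfilter ℕ, ∀ i ∈ s, i < j ∧ c i j = e :=
        (eventually_all_finset s).2 fun i hi => (hgt i).and (hs i hi ▸ hd i)
      exact (he.and this).exists
  exact ⟨e, g, fun i j h => (hg i j h).1, fun i j h => (hg i j h).2⟩

end Ramsey

/-! ### Recognizers -/

/-- A recognizer is a finite algebra given by tables: its size, a multiplication table, a table of
the elements assigned to the letters, and a table of accepted pairs of elements. -/
abbrev Recognizer := ℕ × List ℕ × List ℕ × List Bool

namespace Recognizer

/-- The number of elements. The elements are the natural numbers below it. -/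
def size (D : Recognizer) : ℕ := D.1

/-- The product of two elements. -/
def mul (D : Recognizer) (x y : ℕ) : ℕ := D.2.1.getD (Nat.pair x y) 0

/-- The element assigned to the letter `c`. -/
def letter (D : Recognizer) (c : ℕ) : ℕ := D.2.2.1.getD c 0

/-- Whether the pair `(s, e)` is accepted. -/
def acc (D : Recognizer) (s e : ℕ) : Bool := D.2.2.2.getD (Nat.pair s e) false

/-- The recognizer of size `m` for the letters below `2 ^ K` with the given operations. -/
def ofFn (K m : ℕ) (f : ℕ → ℕ → ℕ) (l : ℕ → ℕ) (a : ℕ → ℕ → Bool) : Recognizer :=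
  (m, tabulate₂ m f, tabulate (2 ^ K) l, tabulate₂ m a)

section ofFn

variable {K m : ℕ} {f : ℕ → ℕ → ℕ} {l : ℕ → ℕ} {a : ℕ → ℕ → Bool}

theorem mul_ofFn {x y : ℕ} (hx : x < m) (hy : y < m) : (ofFn K m f l a).mul x y = f x y :=
  getD_tabulate₂ f 0 hx hy

theorem letter_ofFn {c : ℕ} (hc : c < 2 ^ K) : (ofFn K m f l a).letter c = l c :=
  getD_tabulate l 0 hc

theorem acc_ofFn {x y : ℕ} (hx : x < m) (hy : y < m) : (ofFn K m f l a).acc x y = a x y :=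
  getD_tabulate₂ a false hx hy

end ofFn

/-! ### Valuations and linked factorizations -/

/-- The letter at position `i` of the word of length `ω` given by a sequence of sets. -/
noncomputable def letterAt (K : ℕ) (V : ℕ → Set ℕ) (i : ℕ) : ℕ :=
  open Classical in bitmask K fun t => decide (i ∈ V t)

theorem letterAt_lt (K : ℕ) (V : ℕ → Set ℕ) (i : ℕ) : letterAt K V i < 2 ^ K := bitmask_lt _ _

theorem testBit_letterAt {K t : ℕ} (ht : t < K) (V : ℕ → Set ℕ) (i : ℕ) :
    (letterAt K V i).testBit t = true ↔ i ∈ V t := by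
  classical
  rw [letterAt, testBit_bitmask_of_lt _ ht, decide_eq_true_iff]

/-- `val` assigns to every word `V` and every nonempty segment `[i, j)` the product in `D` of the
elements of the letters in that segment. -/
structure IsValuation (K : ℕ) (D : Recognizer) (val : (ℕ → Set ℕ) → ℕ → ℕ → ℕ) : Prop where
  lt : ∀ V i j, i < j → val V i j < D.size
  letter : ∀ V i, val V i (i + 1) = D.letter (letterAt K V i)
  mul : ∀ V i j k, i < j → j < k → D.mul (val V i j) (val V j k) = val V i k

/-- `D` recognizes the language `L` if the membership of a word in `L` is read off from any
factorization of the word into an initial segment with value `s` and further segments all with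
value `e`, where `e * e = e` and `s * e = s`. -/
def Recognizes (K : ℕ) (D : Recognizer) (L : (ℕ → Set ℕ) → Prop) : Prop :=
  ∃ val, IsValuation K D val ∧ ∀ V (p : ℕ → ℕ) s e, StrictMono p → 0 < p 0 → D.mul e e = e →
    D.mul s e = s → val V 0 (p 0) = s → (∀ n, val V (p n) (p (n + 1)) = e) →
    (L V ↔ D.acc s e = true)

namespace IsValuation

variable {K : ℕ} {D : Recognizer} {val : (ℕ → Set ℕ) → ℕ → ℕ → ℕ}

/-- The value of a segment is a product over its letters, so it depends only on the sets inside the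
segment. This locality is what permits cutting and gluing. -/
theorem congr (h : IsValuation K D val) {V W : ℕ → Set ℕ} {i j : ℕ} (hij : i < j)
    (hVW : ∀ t x, i ≤ x → x < j → (x ∈ V t ↔ x ∈ W t)) : val V i j = val W i j := by
  classical
  induction j, hij using Nat.le_induction with
  | base =>
    rw [h.letter, h.letter]
    congr 1
    exact bitmask_congr fun t _ => by simp [hVW t i le_rfl (Nat.lt_succ_self i)]
  | succ j hj ih =>
    rw [← h.mul V i j (j + 1) hj (Nat.lt_succ_self j), ← h.mul W i j (j + 1) hj (Nat.lt_succ_self j),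
      ih fun t x h₁ h₂ => hVW t x h₁ (by omega), h.letter, h.letter]
    congr 2
    exact bitmask_congr fun t _ => by simp [hVW t j (by omega) (Nat.lt_succ_self j)]

/-- Every factorization has a coarsening all of whose segments have the same value. -/
theorem exists_linked (h : IsValuation K D val) (V : ℕ → Set ℕ) {p : ℕ → ℕ} (hp : StrictMono p)
    (hp0 : 0 < p 0) :
    ∃ (g : ℕ → ℕ) (s e : ℕ), StrictMono g ∧ D.mul e e = e ∧ D.mul s e = s ∧
      val V 0 (p (g 0)) = s ∧ ∀ i j, i < j → val V (p (g i)) (p (g j)) = e := by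
  obtain ⟨e, g, hg, he⟩ := exists_strictMono_homogeneous (fun i j => val V (p i) (p j)) D.size
    fun i j hij => h.lt V _ _ (hp hij)
  have hpos : ∀ i, 0 < p i := fun i => hp0.trans_le (hp.monotone (Nat.zero_le i))
  have hlt : ∀ i j, i < j → p (g i) < p (g j) := fun i j hij => hp (hg hij)
  -- The first homogeneous segment is merged into the initial one, so that the value `s` ends in a
  -- factor `e` and absorbs `e` on the right.
  refine ⟨fun n => g (n + 1), _, e, fun i j hij => hg (by omega), ?_, ?_, rfl,
    fun i j hij => he _ _ (by omega)⟩
  · have := h.mul V _ _ _ (hlt 0 1 one_pos) (hlt 1 2 one_lt_two)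
    rwa [he 0 1 one_pos, he 1 2 one_lt_two, he 0 2 two_pos] at this
  · have h₁ := h.mul V _ _ _ (hpos (g 0)) (hlt 0 1 one_pos)
    have h₂ := h.mul V _ _ _ (hpos (g 0)) (hlt 0 2 two_pos)
    have h₃ := h.mul V _ _ _ (hpos (g 1)) (hlt 1 2 one_lt_two)
    rw [he 0 1 one_pos] at h₁
    rw [he 0 2 two_pos, h₁] at h₂
    rw [he 1 2 one_lt_two, ← h₂] at h₃
    exact h₃

/-- Absorbing finitely many further segments does not change the value of the initial one. -/
theorem val_zero_eq (h : IsValuation K D val) {V : ℕ → Set ℕ} {p : ℕ → ℕ} {s e : ℕ}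
    (hp : StrictMono p) (hp0 : 0 < p 0) (hse : D.mul s e = s) (hs : val V 0 (p 0) = s)
    (he : ∀ n, val V (p n) (p (n + 1)) = e) (n : ℕ) : val V 0 (p n) = s := by
  induction n with
  | zero => exact hs
  | succ n ih =>
    rw [← h.mul V 0 (p n) (p (n + 1)) (hp0.trans_le (hp.monotone (Nat.zero_le n)))
      (hp (Nat.lt_succ_self n)), ih, he, hse]

/-- A union of consecutive segments with the same idempotent value has that value. -/
theorem val_eq_of_idempotent (h : IsValuation K D val) {V : ℕ → Set ℕ} {p : ℕ → ℕ} {e : ℕ}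
    (hp : StrictMono p) (hee : D.mul e e = e) (he : ∀ n, val V (p n) (p (n + 1)) = e) {i j : ℕ}
    (hij : i < j) : val V (p i) (p j) = e := by
  induction j, hij using Nat.le_induction with
  | base => exact he i
  | succ j hj ih =>
    rw [← h.mul V (p i) (p j) (p (j + 1)) (hp hj) (hp (Nat.lt_succ_self j)), ih, he, hee]

end IsValuation

/-! ### Atomic formulas -/

/-- The events that the recognizer of an atomic formula with set variables `a` and `b` watches for
in the segment `[i, j)`: an element of the first set, an element of the second set, an element of
the first set below one of the second, a common element. -/
def Event (a b : ℕ) (V : ℕ → Set ℕ) (i j : ℕ) : ℕ → Prop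
  | 0 => ∃ x, i ≤ x ∧ x < j ∧ x ∈ V a
  | 1 => ∃ x, i ≤ x ∧ x < j ∧ x ∈ V b
  | 2 => ∃ x y, i ≤ x ∧ x < y ∧ y < j ∧ x ∈ V a ∧ y ∈ V b
  | _ => ∃ x, i ≤ x ∧ x < j ∧ x ∈ V a ∧ x ∈ V b

/-- The product of two sets of events. -/
def eventMul (x y : ℕ) : ℕ :=
  bitmask 4 fun z => x.testBit z || y.testBit z || (z == 2 && x.testBit 0 && y.testBit 1)

/-- The events of a segment consisting of a single letter. -/
def eventLetter (a b c : ℕ) : ℕ :=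
  bitmask 4 fun z => (z == 0 && c.testBit a) || (z == 1 && c.testBit b) ||
    (z == 3 && c.testBit a && c.testBit b)

/-- The recognizer for the occurrence of the event `r`. -/
def atom (K r a b : ℕ) : Recognizer :=
  ofFn K (2 ^ 4) eventMul (eventLetter a b) fun s _ => s.testBit r

theorem Event.mono {a b : ℕ} {V : ℕ → Set ℕ} {i j k r : ℕ} (hjk : j ≤ k) (h : Event a b V i j r) :
    Event a b V i k r := by
  match r, h with
  | 0, ⟨x, h₁, h₂, h₃⟩ => exact ⟨x, h₁, h₂.trans_le hjk, h₃⟩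
  | 1, ⟨x, h₁, h₂, h₃⟩ => exact ⟨x, h₁, h₂.trans_le hjk, h₃⟩
  | 2, ⟨x, y, h₁, h₂, h₃, h₄⟩ => exact ⟨x, y, h₁, h₂, h₃.trans_le hjk, h₄⟩
  | _ + 3, ⟨x, h₁, h₂, h₃⟩ => exact ⟨x, h₁, h₂.trans_le hjk, h₃⟩

theorem exists_mem_Ico_iff {P : ℕ → Prop} {i j k : ℕ} (hij : i ≤ j) (hjk : j ≤ k) :
    (∃ x, i ≤ x ∧ x < k ∧ P x) ↔ (∃ x, i ≤ x ∧ x < j ∧ P x) ∨ ∃ x, j ≤ x ∧ x < k ∧ P x := by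
  constructor
  · rintro ⟨x, h₁, h₂, h₃⟩
    rcases lt_or_ge x j with h | h
    exacts [Or.inl ⟨x, h₁, h, h₃⟩, Or.inr ⟨x, h, h₂, h₃⟩]
  · rintro (⟨x, h₁, h₂, h₃⟩ | ⟨x, h₁, h₂, h₃⟩)
    exacts [⟨x, h₁, h₂.trans_le hjk, h₃⟩, ⟨x, hij.trans h₁, h₂, h₃⟩]

/-- Only event 2 can straddle the cut. The right side is bracketed like `eventMul`. -/
theorem event_append {a b : ℕ} {V : ℕ → Set ℕ} {i j k r : ℕ} (hij : i ≤ j) (hjk : j ≤ k) :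
    Event a b V i k r ↔ (Event a b V i j r ∨ Event a b V j k r) ∨
      (r = 2 ∧ Event a b V i j 0) ∧ Event a b V j k 1 := by
  match r with
  | 0 => simpa [Event] using exists_mem_Ico_iff hij hjk
  | 1 => simpa [Event] using exists_mem_Ico_iff hij hjk
  | 2 =>
    simp only [Event, true_and]
    constructor
    · rintro ⟨x, y, h₁, h₂, h₃, h₄, h₅⟩
      rcases lt_or_ge y j with hy | hy
      · exact Or.inl (Or.inl ⟨x, y, h₁, h₂, hy, h₄, h₅⟩)
      rcases lt_or_ge x j with hx | hx
      · exact Or.inr ⟨⟨x, h₁, hx, h₄⟩, ⟨y, hy, h₃, h₅⟩⟩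
      · exact Or.inl (Or.inr ⟨x, y, hx, h₂, h₃, h₄, h₅⟩)
    · rintro ((⟨x, y, h₁, h₂, h₃, h₄, h₅⟩ | ⟨x, y, h₁, h₂, h₃, h₄, h₅⟩) |
        ⟨⟨x, h₁, h₂, h₃⟩, ⟨y, h₄, h₅, h₆⟩⟩)
      · exact ⟨x, y, h₁, h₂, h₃.trans_le hjk, h₄, h₅⟩
      · exact ⟨x, y, hij.trans h₁, h₂, h₃, h₄, h₅⟩
      · exact ⟨x, y, h₁, h₂.trans_le h₄, h₅, h₃, h₆⟩
  | _ + 3 => simpa [Event] using exists_mem_Ico_iff hij hjk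

theorem event_singleton {a b : ℕ} {V : ℕ → Set ℕ} {i r : ℕ} (hr : r < 4) :
    Event a b V i (i + 1) r ↔ ((r = 0 ∧ i ∈ V a) ∨ (r = 1 ∧ i ∈ V b)) ∨
      (r = 3 ∧ i ∈ V a) ∧ i ∈ V b := by
  have key : ∀ P : ℕ → Prop, (∃ x, i ≤ x ∧ x < i + 1 ∧ P x) ↔ P i := fun P =>
    ⟨fun ⟨x, h₁, h₂, h₃⟩ => (show x = i by omega) ▸ h₃,
      fun h => ⟨i, le_rfl, Nat.lt_succ_self i, h⟩⟩
  interval_cases r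
  · simpa [Event] using key (· ∈ V a)
  · simpa [Event] using key (· ∈ V b)
  · simp only [Event]
    constructor
    · rintro ⟨x, y, h₁, h₂, h₃, -⟩
      omega
    · simp
  · simpa [Event] using key fun x => x ∈ V a ∧ x ∈ V b

/-- Since `s * e = s`, all initial segments `[0, p n)` show the same events. An event that ever
occurs is thus already recorded in `s`, and `e` plays no role in acceptance. -/
theorem recognizes_atom {K r a b : ℕ} (hr : r < 4) (ha : a < K) (hb : b < K) :
    Recognizes K (atom K r a b) fun V => ∃ j, Event a b V 0 j r := by
  classical
  have hval : IsValuation K (atom K r a b)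
      fun V i j => bitmask 4 fun z => decide (Event a b V i j z) := by
    refine ⟨fun V i j _ => bitmask_lt _ _, fun V i => ?_, fun V i j k hij hjk => ?_⟩
    · rw [atom, letter_ofFn (letterAt_lt K V i)]
      refine bitmask_congr fun z hz => ?_
      rw [Bool.eq_iff_iff]
      simp [event_singleton hz, testBit_letterAt ha, testBit_letterAt hb]
    · rw [atom, mul_ofFn (bitmask_lt _ _) (bitmask_lt _ _)]
      refine bitmask_congr fun z hz => ?_
      rw [Bool.eq_iff_iff]
      simp [-Nat.testBit_zero, testBit_bitmask, hz, event_append hij.le hjk.le]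
  refine ⟨_, hval, fun V p s e hp hp0 _ hse hs he => ?_⟩
  have hs' := hval.val_zero_eq hp hp0 hse hs he
  have hslt : s < 2 ^ 4 := hs ▸ bitmask_lt _ _
  have helt : e < 2 ^ 4 := he 0 ▸ bitmask_lt _ _
  have hbit : ∀ n, s.testBit r = true ↔ Event a b V 0 (p n) r := fun n => by
    rw [← hs' n, testBit_bitmask_of_lt _ hr, decide_eq_true_iff]
  rw [atom, acc_ofFn hslt helt]
  exact ⟨fun ⟨j, hj⟩ => (hbit j).2 (hj.mono (hp.id_le j)), fun h => ⟨p 0, (hbit 0).1 h⟩⟩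

/-! ### Boolean connectives -/

/-- The recognizer for the complement. -/
def compl (K : ℕ) (D : Recognizer) : Recognizer :=
  ofFn K D.size D.mul D.letter fun s e => !D.acc s e

/-- The valuation is unchanged. Acceptance may be negated because it is equivalent to membership for
every linked factorization. -/
theorem Recognizes.compl {K : ℕ} {D : Recognizer} {L : (ℕ → Set ℕ) → Prop} (h : Recognizes K D L) :
    Recognizes K (compl K D) fun V => ¬ L V := by
  obtain ⟨val, hval, hL⟩ := h
  refine ⟨val, ⟨hval.lt, fun V i => ?_, fun V i j k hij hjk => ?_⟩,
    fun V p s e hp hp0 hee hse hs he => ?_⟩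
  · rw [Recognizer.compl, letter_ofFn (letterAt_lt K V i), hval.letter]
  · rw [Recognizer.compl, mul_ofFn (hval.lt _ _ _ hij) (hval.lt _ _ _ hjk),
      hval.mul _ _ _ _ hij hjk]
  · have hslt : s < D.size := hs ▸ hval.lt _ _ _ hp0
    have helt : e < D.size := he 0 ▸ hval.lt _ _ _ (hp one_pos)
    rw [Recognizer.compl, mul_ofFn helt helt] at hee
    rw [Recognizer.compl, mul_ofFn hslt helt] at hse
    rw [Recognizer.compl, acc_ofFn hslt helt]
    beta_reduce
    rw [hL V p s e hp hp0 hee hse hs he]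
    simp

/-- The recognizer for the intersection. -/
def inter (K : ℕ) (D E : Recognizer) : Recognizer :=
  ofFn K ((D.size + E.size + 1) ^ 2)
    (fun x y => Nat.pair (D.mul x.unpair.1 y.unpair.1) (E.mul x.unpair.2 y.unpair.2))
    (fun c => Nat.pair (D.letter c) (E.letter c))
    fun s e => D.acc s.unpair.1 e.unpair.1 && E.acc s.unpair.2 e.unpair.2

/-- Both coordinates of a linked pair in the product algebra are linked, so one factorization serves
both recognizers. -/
theorem Recognizes.inter {K : ℕ} {D E : Recognizer} {L M : (ℕ → Set ℕ) → Prop}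
    (hD : Recognizes K D L) (hE : Recognizes K E M) :
    Recognizes K (inter K D E) fun V => L V ∧ M V := by
  obtain ⟨v, hv, hL⟩ := hD
  obtain ⟨w, hw, hM⟩ := hE
  have hlt : ∀ V i j, i < j → Nat.pair (v V i j) (w V i j) < (D.size + E.size + 1) ^ 2 :=
    fun V i j hij => pair_lt_sq (hv.lt _ _ _ hij) (hw.lt _ _ _ hij)
  refine ⟨fun V i j => Nat.pair (v V i j) (w V i j), ⟨hlt, fun V i => ?_,
    fun V i j k hij hjk => ?_⟩, fun V p s e hp hp0 hee hse hs he => ?_⟩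
  · rw [Recognizer.inter, letter_ofFn (letterAt_lt K V i), hv.letter, hw.letter]
  · rw [Recognizer.inter, mul_ofFn (hlt _ _ _ hij) (hlt _ _ _ hjk)]
    simp [hv.mul _ _ _ _ hij hjk, hw.mul _ _ _ _ hij hjk]
  · have hslt : s < (D.size + E.size + 1) ^ 2 := hs ▸ hlt _ _ _ hp0
    have helt : e < (D.size + E.size + 1) ^ 2 := he 0 ▸ hlt _ _ _ (hp one_pos)
    rw [Recognizer.inter, mul_ofFn helt helt] at hee
    rw [Recognizer.inter, mul_ofFn hslt helt] at hse
    have hee₁ := congrArg (fun x => x.unpair.1) hee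
    have hee₂ := congrArg (fun x => x.unpair.2) hee
    have hse₁ := congrArg (fun x => x.unpair.1) hse
    have hse₂ := congrArg (fun x => x.unpair.2) hse
    simp only [Nat.unpair_pair] at hee₁ hee₂ hse₁ hse₂
    rw [Recognizer.inter, acc_ofFn hslt helt, Bool.and_eq_true]
    beta_reduce
    rw [
      hL V p _ _ hp hp0 hee₁ hse₁ (by simp [← hs]) (fun n => by simp [← he n]),
      hM V p _ _ hp hp0 hee₂ hse₂ (by simp [← hs]) (fun n => by simp [← he n])]

/-! ### Quantification over sets -/

/-- The recognizer for the projection along the set variable `k`. Its elements are the sets of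
elements of `D`. -/
def proj (K k : ℕ) (D : Recognizer) : Recognizer :=
  ofFn K (2 ^ D.size)
    (fun X Y => bitmask D.size fun z => decide (∃ x < D.size, ∃ y < D.size,
      X.testBit x = true ∧ Y.testBit y = true ∧ D.mul x y = z))
    -- A letter has two expansions, with the digit `k` cleared or set.
    (fun c => bitmask D.size fun z =>
      (z == D.letter (bitmask K fun t => !(t == k) && c.testBit t)) ||
        (z == D.letter (bitmask K fun t => t == k || c.testBit t)))
    fun X E => decide (∃ s < D.size, ∃ e < D.size, X.testBit s = true ∧ E.testBit e = true ∧
      D.mul e e = e ∧ D.mul s e = s ∧ D.acc s e = true)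

/-- Gluing of sets along a factorization. -/
theorem exists_glue {p : ℕ → ℕ} (hp : StrictMono p) (P₀ : Set ℕ) (P : ℕ → Set ℕ) :
    ∃ Q : Set ℕ, (∀ x < p 0, x ∈ Q ↔ x ∈ P₀) ∧
      ∀ n x, p n ≤ x → x < p (n + 1) → (x ∈ Q ↔ x ∈ P n) := by
  refine ⟨{x | (x < p 0 ∧ x ∈ P₀) ∨ ∃ n, p n ≤ x ∧ x < p (n + 1) ∧ x ∈ P n}, fun x hx => ?_,
    fun n x h₁ h₂ => ?_⟩
  · constructor
    · rintro (h | ⟨n, h, -⟩)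
      · exact h.2
      · have := hp.monotone (Nat.zero_le n)
        omega
    · exact fun h => Or.inl ⟨hx, h⟩
  · constructor
    · rintro (⟨h, -⟩ | ⟨m, h₃, h₄, h₅⟩)
      · have := hp.monotone (Nat.zero_le n)
        omega
      · have hmn : m < n + 1 := hp.lt_iff_lt.1 (h₃.trans_lt h₂)
        have hnm : n < m + 1 := hp.lt_iff_lt.1 (h₁.trans_lt h₄)
        exact (show m = n by omega) ▸ h₅
    · exact fun h => Or.inr ⟨n, h₁, h₂, h⟩

theorem mem_update_congr {V : ℕ → Set ℕ} {k x : ℕ} {P Q : Set ℕ} (h : x ∈ P ↔ x ∈ Q) (t : ℕ) :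
    x ∈ Function.update V k P t ↔ x ∈ Function.update V k Q t := by
  rcases eq_or_ne t k with rfl | ht
  · simpa using h
  · simp [ht]

/-- The value of a segment in the projection: the set of the values of its expansions. -/
noncomputable def projVal (D : Recognizer) (k : ℕ) (val : (ℕ → Set ℕ) → ℕ → ℕ → ℕ)
    (V : ℕ → Set ℕ) (i j : ℕ) : ℕ :=
  open Classical in
  bitmask D.size fun z => decide (∃ P : Set ℕ, val (Function.update V k P) i j = z)

theorem projVal_lt (D : Recognizer) (k : ℕ) (val : (ℕ → Set ℕ) → ℕ → ℕ → ℕ)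
    (V : ℕ → Set ℕ) (i j : ℕ) : projVal D k val V i j < 2 ^ D.size := bitmask_lt _ _

theorem testBit_projVal {D : Recognizer} {val : (ℕ → Set ℕ) → ℕ → ℕ → ℕ} {z : ℕ} (hz : z < D.size)
    (k : ℕ) (V : ℕ → Set ℕ) (i j : ℕ) :
    (projVal D k val V i j).testBit z = true ↔
      ∃ P : Set ℕ, val (Function.update V k P) i j = z := by
  classical
  rw [projVal, testBit_bitmask_of_lt _ hz, decide_eq_true_iff]

theorem letterAt_update_of_notMem {K k i : ℕ} {V : ℕ → Set ℕ} {P : Set ℕ} (h : i ∉ P) :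
    letterAt K (Function.update V k P) i =
      bitmask K fun t => !(t == k) && (letterAt K V i).testBit t := by
  classical
  refine bitmask_congr fun t ht => ?_
  rcases eq_or_ne t k with rfl | hk
  · simp [h]
  · rw [Bool.eq_iff_iff]
    simp [hk, testBit_letterAt ht]

theorem letterAt_update_of_mem {K k i : ℕ} {V : ℕ → Set ℕ} {P : Set ℕ} (h : i ∈ P) :
    letterAt K (Function.update V k P) i =
      bitmask K fun t => t == k || (letterAt K V i).testBit t := by
  classical
  refine bitmask_congr fun t ht => ?_
  rcases eq_or_ne t k with rfl | hk
  · simp [h]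
  · rw [Bool.eq_iff_iff]
    simp [hk, testBit_letterAt ht]

/-- Two expansions, one for each of two adjacent segments, combine into an expansion of their union,
so the value sets multiply elementwise. -/
theorem IsValuation.proj {K : ℕ} {D : Recognizer} {val : (ℕ → Set ℕ) → ℕ → ℕ → ℕ}
    (h : IsValuation K D val) (k : ℕ) : IsValuation K (proj K k D) (projVal D k val) := by
  classical
  refine ⟨fun V i j _ => projVal_lt D k val V i j, fun V i => ?_, fun V i j l hij hjl => ?_⟩
  · rw [Recognizer.proj, letter_ofFn (letterAt_lt K V i)]
    refine bitmask_congr fun z _ => ?_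
    rw [Bool.eq_iff_iff, decide_eq_true_iff, Bool.or_eq_true, beq_iff_eq, beq_iff_eq]
    constructor
    · rintro ⟨P, hP⟩
      rw [h.letter] at hP
      by_cases hi : i ∈ P
      · exact Or.inr (by rw [← hP, letterAt_update_of_mem hi])
      · exact Or.inl (by rw [← hP, letterAt_update_of_notMem hi])
    · rintro (rfl | rfl)
      · exact ⟨∅, by rw [h.letter, letterAt_update_of_notMem (Set.notMem_empty i)]⟩
      · exact ⟨Set.univ, by rw [h.letter, letterAt_update_of_mem (Set.mem_univ i)]⟩
  · rw [Recognizer.proj, mul_ofFn (projVal_lt ..) (projVal_lt ..)]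
    refine bitmask_congr fun z _ => ?_
    rw [Bool.eq_iff_iff, decide_eq_true_iff, decide_eq_true_iff]
    constructor
    · rintro ⟨x, hx, y, hy, hxP, hyP, rfl⟩
      obtain ⟨P, rfl⟩ := (testBit_projVal hx k V i j).1 hxP
      obtain ⟨Q, rfl⟩ := (testBit_projVal hy k V j l).1 hyP
      refine ⟨{x | (x < j ∧ x ∈ P) ∨ (j ≤ x ∧ x ∈ Q)}, ?_⟩
      rw [← h.mul _ i j l hij hjl]
      congr 1
      · refine h.congr hij fun t x _ h₂ => mem_update_congr ?_ t
        simp [h₂, h₂.not_ge]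
      · refine h.congr hjl fun t x h₁ _ => mem_update_congr ?_ t
        simp [h₁, h₁.not_gt]
    · rintro ⟨P, rfl⟩
      have h₁ := h.lt (Function.update V k P) i j hij
      have h₂ := h.lt (Function.update V k P) j l hjl
      exact ⟨_, h₁, _, h₂, (testBit_projVal h₁ k V i j).2 ⟨P, rfl⟩,
        (testBit_projVal h₂ k V j l).2 ⟨P, rfl⟩, h.mul _ i j l hij hjl⟩

/-- A witness `P` need not give equal values on the segments of `p`; Ramsey's theorem regroups them
into a linked factorization. Conversely, `s ∈ X` and `e ∈ E` provide a witness on each segment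
separately, and these are glued. -/
theorem Recognizes.proj {K : ℕ} {D : Recognizer} {L : (ℕ → Set ℕ) → Prop} (h : Recognizes K D L)
    (k : ℕ) : Recognizes K (proj K k D) fun V => ∃ P : Set ℕ, L (Function.update V k P) := by
  obtain ⟨val, hval, hL⟩ := h
  refine ⟨_, hval.proj k, fun V p X E hp hp0 hEE hXE hX hE => ?_⟩
  have hXlt : X < 2 ^ D.size := hX ▸ projVal_lt ..
  have hElt : E < 2 ^ D.size := hE 0 ▸ projVal_lt ..
  rw [Recognizer.proj, acc_ofFn hXlt hElt, decide_eq_true_iff]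
  constructor
  · rintro ⟨P, hP⟩
    obtain ⟨g, s, e, hg, hee, hse, hs, he⟩ := hval.exists_linked (Function.update V k P) hp hp0
    have hgpos : 0 < p (g 0) := hp0.trans_le (hp.monotone (Nat.zero_le _))
    have hslt : s < D.size := hs ▸ hval.lt _ _ _ hgpos
    have helt : e < D.size := he 0 1 one_pos ▸ hval.lt _ _ _ (hp (hg one_pos))
    refine ⟨s, hslt, e, helt, ?_, ?_, hee, hse, ?_⟩
    -- Regrouping leaves the projected values `X` and `E` unchanged, because `(X, E)` is itself
    -- linked.
    · rw [← (hval.proj k).val_zero_eq hp hp0 hXE hX hE (g 0), testBit_projVal hslt]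
      exact ⟨P, hs⟩
    · rw [← (hval.proj k).val_eq_of_idempotent hp hEE hE (hg one_pos), testBit_projVal helt]
      exact ⟨P, he 0 1 one_pos⟩
    · exact (hL _ (fun n => p (g n)) s e (hp.comp hg) hgpos hee hse hs
        fun n => he _ _ (Nat.lt_succ_self n)).1 hP
  · rintro ⟨s, hslt, e, helt, hsX, heE, hee, hse, hacc⟩
    rw [← hX, testBit_projVal hslt] at hsX
    obtain ⟨P₀, hP₀⟩ := hsX
    have hE' : ∀ n, ∃ P : Set ℕ, val (Function.update V k P) (p n) (p (n + 1)) = e := fun n => by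
      rwa [← hE n, testBit_projVal helt] at heE
    choose P hP using hE'
    obtain ⟨Q, hQ₀, hQ⟩ := exists_glue hp P₀ P
    refine ⟨Q, (hL _ p s e hp hp0 hee hse ?_ fun n => ?_).2 hacc⟩
    · rw [← hP₀]
      exact hval.congr hp0 fun t x _ hx => mem_update_congr (hQ₀ x hx) t
    · rw [← hP n]
      exact hval.congr (hp (Nat.lt_succ_self n)) fun t x h₁ h₂ => mem_update_congr (hQ n x h₁ h₂) t

end Recognizer

/-! ### The constructions on recognizers are primitive recursive -/

namespace Recognizer

section Primrec

variable {α : Type*} [Primcodable α]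

theorem primrec_size : Primrec size := Primrec.fst

theorem primrec_mul {D : α → Recognizer} {x y : α → ℕ} (hD : Primrec D) (hx : Primrec x)
    (hy : Primrec y) : Primrec fun a => (D a).mul (x a) (y a) :=
  (Primrec.list_getD 0).comp (Primrec.fst.comp (Primrec.snd.comp hD)) (Primrec₂.natPair.comp hx hy)

theorem primrec_letter {D : α → Recognizer} {c : α → ℕ} (hD : Primrec D) (hc : Primrec c) :
    Primrec fun a => (D a).letter (c a) :=
  (Primrec.list_getD 0).comp (Primrec.fst.comp (Primrec.snd.comp (Primrec.snd.comp hD))) hc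

theorem primrec_acc {D : α → Recognizer} {x y : α → ℕ} (hD : Primrec D) (hx : Primrec x)
    (hy : Primrec y) : Primrec fun a => (D a).acc (x a) (y a) :=
  (Primrec.list_getD false).comp (Primrec.snd.comp (Primrec.snd.comp (Primrec.snd.comp hD)))
    (Primrec₂.natPair.comp hx hy)

theorem primrec_ofFn {K m : α → ℕ} {f : α → ℕ → ℕ → ℕ} {l : α → ℕ → ℕ} {b : α → ℕ → ℕ → Bool}
    (hK : Primrec K) (hm : Primrec m) (hf : Primrec fun p : α × ℕ × ℕ => f p.1 p.2.1 p.2.2)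
    (hl : Primrec₂ l) (hb : Primrec fun p : α × ℕ × ℕ => b p.1 p.2.1 p.2.2) :
    Primrec fun a => ofFn (K a) (m a) (f a) (l a) (b a) :=
  Primrec.pair hm (Primrec.pair (primrec_tabulate₂ hm hf) (Primrec.pair
    (primrec_tabulate (primrec₂_pow.comp (Primrec.const 2) hK) hl) (primrec_tabulate₂ hm hb)))

theorem primrec_bitmask_pair {β : Type*} [Primcodable β] {n : β → ℕ} {p : β → ℕ → Bool}
    (hn : Primrec n) (hp : Primrec fun q : β × ℕ => p q.1 q.2) :
    Primrec fun b => bitmask (n b) (p b) :=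
  primrec_bitmask hn hp

theorem primrec_atom (r : ℕ) {K a b : α → ℕ} (hK : Primrec K) (ha : Primrec a) (hb : Primrec b) :
    Primrec fun x => atom (K x) r (a x) (b x) := by
  have hz : ∀ c, Primrec fun q : (α × ℕ) × ℕ => q.2 == c := fun c =>
    Primrec.beq.comp Primrec.snd (Primrec.const c)
  have hc : Primrec fun q : (α × ℕ) × ℕ => q.1.2 := Primrec.snd.comp Primrec.fst
  have hca : Primrec fun q : (α × ℕ) × ℕ => q.1.2.testBit (a q.1.1) :=
    primrec₂_testBit.comp hc (ha.comp (Primrec.fst.comp Primrec.fst))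
  have hcb : Primrec fun q : (α × ℕ) × ℕ => q.1.2.testBit (b q.1.1) :=
    primrec₂_testBit.comp hc (hb.comp (Primrec.fst.comp Primrec.fst))
  -- Of the four components only the letter table varies with the parameters.
  refine Primrec.pair (Primrec.const _) (Primrec.pair (Primrec.const _) (Primrec.pair
    (primrec_tabulate (primrec₂_pow.comp (Primrec.const 2) hK) ?_) (Primrec.const _)))
  exact primrec_bitmask_pair (Primrec.const 4) (Primrec.or.comp (Primrec.or.comp
    (Primrec.and.comp (hz 0) hca) (Primrec.and.comp (hz 1) hcb))
    (Primrec.and.comp (Primrec.and.comp (hz 3) hca) hcb))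

theorem primrec_compl {K : α → ℕ} {D : α → Recognizer} (hK : Primrec K) (hD : Primrec D) :
    Primrec fun a => compl (K a) (D a) := by
  have hD' : Primrec fun p : α × ℕ × ℕ => D p.1 := hD.comp Primrec.fst
  have hx : Primrec fun p : α × ℕ × ℕ => p.2.1 := Primrec.fst.comp Primrec.snd
  have hy : Primrec fun p : α × ℕ × ℕ => p.2.2 := Primrec.snd.comp Primrec.snd
  exact primrec_ofFn hK (primrec_size.comp hD) (primrec_mul hD' hx hy)
    (primrec_letter (hD.comp Primrec.fst) Primrec.snd) (Primrec.not.comp (primrec_acc hD' hx hy))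

theorem primrec_inter {K : α → ℕ} {D E : α → Recognizer} (hK : Primrec K) (hD : Primrec D)
    (hE : Primrec E) : Primrec fun a => inter (K a) (D a) (E a) := by
  have hD' : Primrec fun p : α × ℕ × ℕ => D p.1 := hD.comp Primrec.fst
  have hE' : Primrec fun p : α × ℕ × ℕ => E p.1 := hE.comp Primrec.fst
  have hx : Primrec fun p : α × ℕ × ℕ => p.2.1.unpair :=
    Primrec.unpair.comp (Primrec.fst.comp Primrec.snd)
  have hy : Primrec fun p : α × ℕ × ℕ => p.2.2.unpair :=
    Primrec.unpair.comp (Primrec.snd.comp Primrec.snd)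
  have hx₁ := Primrec.fst.comp hx
  have hx₂ := Primrec.snd.comp hx
  have hy₁ := Primrec.fst.comp hy
  have hy₂ := Primrec.snd.comp hy
  refine primrec_ofFn hK ?_ ?_ ?_ ?_
  · exact primrec₂_pow.comp (Primrec.succ.comp
      (Primrec.nat_add.comp (primrec_size.comp hD) (primrec_size.comp hE))) (Primrec.const 2)
  · exact Primrec₂.natPair.comp (primrec_mul hD' hx₁ hy₁) (primrec_mul hE' hx₂ hy₂)
  · exact Primrec₂.natPair.comp (primrec_letter (hD.comp Primrec.fst) Primrec.snd)
      (primrec_letter (hE.comp Primrec.fst) Primrec.snd)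
  · exact Primrec.and.comp (primrec_acc hD' hx₁ hy₁) (primrec_acc hE' hx₂ hy₂)

theorem primrec_proj {K k : α → ℕ} {D : α → Recognizer} (hK : Primrec K) (hk : Primrec k)
    (hD : Primrec D) : Primrec fun a => proj (K a) (k a) (D a) := by
  have hn := primrec_size.comp hD
  refine primrec_ofFn hK (primrec₂_pow.comp (Primrec.const 2) hn) ?_ ?_ ?_
  · refine primrec_bitmask_pair (hn.comp Primrec.fst) (PrimrecPred.decide ?_)
    refine PrimrecPred.exists_lt_of (hn.comp (Primrec.fst.comp Primrec.fst)) ?_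
    refine PrimrecPred.exists_lt_of
      (hn.comp (Primrec.fst.comp (Primrec.fst.comp Primrec.fst))) ?_
    have hx : Primrec fun p : (((α × ℕ × ℕ) × ℕ) × ℕ) × ℕ => p.1.2 := Primrec.snd.comp Primrec.fst
    have hy : Primrec fun p : (((α × ℕ × ℕ) × ℕ) × ℕ) × ℕ => p.2 := Primrec.snd
    have hp : Primrec fun p : (((α × ℕ × ℕ) × ℕ) × ℕ) × ℕ => p.1.1.1 :=
      Primrec.fst.comp (Primrec.fst.comp Primrec.fst)
    have hX := Primrec.fst.comp (Primrec.snd.comp hp)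
    have hY := Primrec.snd.comp (Primrec.snd.comp hp)
    have hz : Primrec fun p : (((α × ℕ × ℕ) × ℕ) × ℕ) × ℕ => p.1.1.2 :=
      Primrec.snd.comp (Primrec.fst.comp Primrec.fst)
    exact (Primrec.eq.comp (primrec₂_testBit.comp hX hx) (Primrec.const true)).and
      ((Primrec.eq.comp (primrec₂_testBit.comp hY hy) (Primrec.const true)).and
        (Primrec.eq.comp (primrec_mul (hD.comp (Primrec.fst.comp hp)) hx hy) hz))
  · refine primrec_bitmask_pair (hn.comp Primrec.fst) ?_
    have hD' : Primrec fun p : (α × ℕ) × ℕ => D p.1.1 :=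
      hD.comp (Primrec.fst.comp Primrec.fst)
    have hK' : Primrec fun p : (α × ℕ) × ℕ => K p.1.1 :=
      hK.comp (Primrec.fst.comp Primrec.fst)
    have htk : Primrec fun p : ((α × ℕ) × ℕ) × ℕ => p.2 == k p.1.1.1 :=
      Primrec.beq.comp Primrec.snd
        (hk.comp (Primrec.fst.comp (Primrec.fst.comp Primrec.fst)))
    have hct : Primrec fun p : ((α × ℕ) × ℕ) × ℕ => p.1.1.2.testBit p.2 :=
      primrec₂_testBit.comp (Primrec.snd.comp (Primrec.fst.comp Primrec.fst)) Primrec.snd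
    exact Primrec.or.comp
      (Primrec.beq.comp Primrec.snd (primrec_letter hD' (primrec_bitmask_pair hK'
        (Primrec.and.comp (Primrec.not.comp htk) hct))))
      (Primrec.beq.comp Primrec.snd (primrec_letter hD' (primrec_bitmask_pair hK'
        (Primrec.or.comp htk hct))))
  · refine PrimrecPred.decide (PrimrecPred.exists_lt_of (hn.comp Primrec.fst)
      (PrimrecPred.exists_lt_of (hn.comp (Primrec.fst.comp Primrec.fst)) ?_))
    have hs : Primrec fun p : ((α × ℕ × ℕ) × ℕ) × ℕ => p.1.2 := Primrec.snd.comp Primrec.fst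
    have he : Primrec fun p : ((α × ℕ × ℕ) × ℕ) × ℕ => p.2 := Primrec.snd
    have hp : Primrec fun p : ((α × ℕ × ℕ) × ℕ) × ℕ => p.1.1 := Primrec.fst.comp Primrec.fst
    have hD' := hD.comp (Primrec.fst.comp hp)
    have hX := Primrec.fst.comp (Primrec.snd.comp hp)
    have hE := Primrec.snd.comp (Primrec.snd.comp hp)
    exact (Primrec.eq.comp (primrec₂_testBit.comp hX hs) (Primrec.const true)).and
      ((Primrec.eq.comp (primrec₂_testBit.comp hE he) (Primrec.const true)).and
        ((Primrec.eq.comp (primrec_mul hD' he he) he).and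
          ((Primrec.eq.comp (primrec_mul hD' hs he) hs).and
            (Primrec.eq.comp (primrec_acc hD' hs he) (Primrec.const true)))))

end Primrec

/-! ### The word all of whose sets are empty -/

/-- The product of `n + 1` copies of the element of the letter `0`. -/
def power (D : Recognizer) (n : ℕ) : ℕ :=
  Nat.rec (D.letter 0) (fun _ x => D.mul x (D.letter 0)) n

/-- The code `n` of a pair of powers of the letter `0` that can occur as the values of the segments
of a factorization of the word `000...`. -/
def IsLinked (D : Recognizer) (n : ℕ) : Prop :=
  D.mul (D.power n.unpair.2) (D.power n.unpair.2) = D.power n.unpair.2 ∧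
    D.mul (D.power n.unpair.1) (D.power n.unpair.2) = D.power n.unpair.1

instance (D : Recognizer) (n : ℕ) : Decidable (D.IsLinked n) :=
  inferInstanceAs (Decidable (_ ∧ _))

theorem primrec₂_power : Primrec₂ power :=
  Primrec.nat_rec (f := fun D : Recognizer => D.letter 0)
    (g := fun (D : Recognizer) (q : ℕ × ℕ) => D.mul q.2 (D.letter 0))
    (primrec_letter Primrec.id (Primrec.const 0))
    (Primrec₂.mk <| primrec_mul Primrec.fst (Primrec.snd.comp Primrec.snd)
      (primrec_letter Primrec.fst (Primrec.const 0)))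

theorem primrecPred_isLinked : PrimrecPred fun p : Recognizer × ℕ => p.1.IsLinked p.2 := by
  have hn : Primrec fun p : Recognizer × ℕ => p.2.unpair := Primrec.unpair.comp Primrec.snd
  have hs := primrec₂_power.comp Primrec.fst (Primrec.fst.comp hn)
  have he := primrec₂_power.comp Primrec.fst (Primrec.snd.comp hn)
  exact (Primrec.eq.comp (primrec_mul Primrec.fst he he) he).and
    (Primrec.eq.comp (primrec_mul Primrec.fst hs he) hs)

theorem IsValuation.empty_eq_power {K : ℕ} {D : Recognizer} {val : (ℕ → Set ℕ) → ℕ → ℕ → ℕ}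
    (h : IsValuation K D val) {i j : ℕ} (hij : i < j) :
    val (fun _ => ∅) i j = D.power (j - i - 1) := by
  have h0 : ∀ i, letterAt K (fun _ => ∅) i = 0 := fun i =>
    Nat.zero_of_testBit_eq_false fun t => by simp [letterAt, testBit_bitmask]
  induction j, hij using Nat.le_induction with
  | base => rw [h.letter, h0]; simp [power]
  | succ j hj ih =>
    rw [← h.mul _ i j (j + 1) hj (Nat.lt_succ_self j), ih, h.letter, h0]
    have : j + 1 - i - 1 = (j - i - 1) + 1 := by omega
    rw [this]
    rfl

/-- Ramsey's theorem applied to the cutting of the empty-set word into single letters; this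
guarantees that the search for a linked pair ends. -/
theorem Recognizes.exists_isLinked {K : ℕ} {D : Recognizer} {L : (ℕ → Set ℕ) → Prop}
    (h : Recognizes K D L) : ∃ n, D.IsLinked n := by
  obtain ⟨val, hval, -⟩ := h
  have hp : StrictMono fun n : ℕ => n + 1 := fun i j hij => Nat.add_lt_add_right hij 1
  obtain ⟨g, s, e, hg, hee, hse, hs, he⟩ := hval.exists_linked (fun _ => ∅) hp one_pos
  have hs' := (hval.empty_eq_power (Nat.succ_pos (g 0))).symm.trans hs
  have he' := (hval.empty_eq_power (hp (hg one_pos))).symm.trans (he 0 1 one_pos)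
  refine ⟨Nat.pair (g 0 + 1 - 0 - 1) (g 1 + 1 - (g 0 + 1) - 1), ?_⟩
  rw [IsLinked, Nat.unpair_pair, hs', he']
  exact ⟨hee, hse⟩

/-- Any linked pair will do: cut the word into an initial block of length `n.unpair.1 + 1` and
further blocks of length `n.unpair.2 + 1`. -/
theorem Recognizes.empty_iff {K : ℕ} {D : Recognizer} {L : (ℕ → Set ℕ) → Prop}
    (h : Recognizes K D L) {n : ℕ} (hn : D.IsLinked n) :
    L (fun _ => ∅) ↔ D.acc (D.power n.unpair.1) (D.power n.unpair.2) = true := by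
  obtain ⟨val, hval, hL⟩ := h
  have hp : StrictMono fun m => (n.unpair.1 + 1) + m * (n.unpair.2 + 1) :=
    strictMono_nat_of_lt_succ fun m => by rw [Nat.succ_mul]; omega
  refine hL _ _ _ _ hp (by omega) hn.1 hn.2 ?_ fun m => ?_
  · rw [hval.empty_eq_power (by omega)]
    congr 1
    omega
  · rw [hval.empty_eq_power (hp (Nat.lt_succ_self m))]
    congr 1
    simp only [Nat.succ_mul]
    omega

end Recognizer

namespace MonFormula

/-! ### Formulas as languages of words

The individual variable `x_i` is treated as the set variable with index `2 * i`, to be interpreted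
by singletons, and the set variable `X_k` gets the index `2 * k + 1`. -/

/-- The language defined by a formula: satisfaction in `ω` under an assignment of sets to all
variables. -/
def lang : MonFormula → (ℕ → Set ℕ) → Prop
  | lt i j, V => ∃ n, Recognizer.Event (2 * i) (2 * j) V 0 n 2
  | eq i j, V => ∃ n, Recognizer.Event (2 * i) (2 * j) V 0 n 3
  | mem i k, V => ∃ n, Recognizer.Event (2 * i) (2 * k + 1) V 0 n 3
  | neg φ, V => ¬ φ.lang V
  | and φ ψ, V => φ.lang V ∧ ψ.lang V
  | exInd i φ, V => ∃ P : Set ℕ,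
      -- With both sets equal to `P`, event 3 says that `P` is nonempty and the absence of event 2
      -- that it has at most one element.
      ((∃ n, Recognizer.Event (2 * i) (2 * i) (Function.update V (2 * i) P) 0 n 3) ∧
        ¬ ∃ n, Recognizer.Event (2 * i) (2 * i) (Function.update V (2 * i) P) 0 n 2) ∧
      φ.lang (Function.update V (2 * i) P)
  | exSet k φ, V => ∃ P : Set ℕ, φ.lang (Function.update V (2 * k + 1) P)

/-- The sets assigned to all variables by the assignments `v` and `V`. -/
def joint (v : ℕ → ℕ) (V : ℕ → Set ℕ) (t : ℕ) : Set ℕ :=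
  if t % 2 = 0 then {v (t / 2)} else V (t / 2)

theorem joint_even (v : ℕ → ℕ) (V : ℕ → Set ℕ) (i : ℕ) : joint v V (2 * i) = {v i} := by
  simp [joint]

theorem joint_odd (v : ℕ → ℕ) (V : ℕ → Set ℕ) (k : ℕ) : joint v V (2 * k + 1) = V k := by
  have : (2 * k + 1) / 2 = k := by omega
  simp [joint, this, Nat.add_mod]

theorem joint_update_left (v : ℕ → ℕ) (V : ℕ → Set ℕ) (i a : ℕ) :
    joint (Function.update v i a) V = Function.update (joint v V) (2 * i) {a} := by
  funext t
  obtain ⟨j, rfl | rfl⟩ := Nat.even_or_odd' t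
  · rcases eq_or_ne j i with rfl | h
    · simp [joint_even]
    · simp [joint_even, h]
  · rw [Function.update_of_ne (by omega), joint_odd, joint_odd]

theorem joint_update_right (v : ℕ → ℕ) (V : ℕ → Set ℕ) (k : ℕ) (P : Set ℕ) :
    joint v (Function.update V k P) = Function.update (joint v V) (2 * k + 1) P := by
  funext t
  obtain ⟨j, rfl | rfl⟩ := Nat.even_or_odd' t
  · rw [Function.update_of_ne (by omega), joint_even, joint_even]
  · rcases eq_or_ne j k with rfl | h
    · simp [joint_odd]
    · simp [joint_odd, h]

theorem exists_event_lt {a b : ℕ} {V : ℕ → Set ℕ} :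
    (∃ n, Recognizer.Event a b V 0 n 2) ↔ ∃ x ∈ V a, ∃ y ∈ V b, x < y := by
  constructor
  · rintro ⟨n, x, y, -, h₁, -, h₂, h₃⟩
    exact ⟨x, h₂, y, h₃, h₁⟩
  · rintro ⟨x, h₂, y, h₃, h₁⟩
    exact ⟨y + 1, x, y, x.zero_le, h₁, y.lt_succ_self, h₂, h₃⟩

theorem exists_event_meet {a b : ℕ} {V : ℕ → Set ℕ} :
    (∃ n, Recognizer.Event a b V 0 n 3) ↔ ∃ x ∈ V a, x ∈ V b := by
  constructor
  · rintro ⟨n, x, -, -, h₁, h₂⟩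
    exact ⟨x, h₁, h₂⟩
  · rintro ⟨x, h₁, h₂⟩
    exact ⟨x + 1, x, x.zero_le, x.lt_succ_self, h₁, h₂⟩

theorem exists_singleton_iff (P : Set ℕ) :
    ((∃ x ∈ P, x ∈ P) ∧ ¬ ∃ x ∈ P, ∃ y ∈ P, x < y) ↔ ∃ a, P = {a} := by
  constructor
  · rintro ⟨⟨a, ha, -⟩, h⟩
    refine ⟨a, Set.eq_singleton_iff_unique_mem.2 ⟨ha, fun x hx => ?_⟩⟩
    rcases lt_trichotomy x a with hlt | heq | hlt
    · exact absurd ⟨x, hx, a, ha, hlt⟩ h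
    · exact heq
    · exact absurd ⟨a, ha, x, hx, hlt⟩ h
  · rintro ⟨a, rfl⟩
    simp

theorem lang_joint (φ : MonFormula) (v : ℕ → ℕ) (V : ℕ → Set ℕ) :
    φ.lang (joint v V) ↔ φ.Sat ℕ v V := by
  induction φ generalizing v V with
  | lt i j => simp [lang, Sat, exists_event_lt, joint_even]
  | eq i j => simp [lang, Sat, exists_event_meet, joint_even]
  | mem i k => simp [lang, Sat, exists_event_meet, joint_even, joint_odd]
  | neg φ ih => simp only [lang, Sat, ih]
  | and φ ψ ih₁ ih₂ => simp only [lang, Sat, ih₁, ih₂]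
  | exInd i φ ih =>
    simp only [lang, Sat, exists_event_lt, exists_event_meet, Function.update_self,
      exists_singleton_iff]
    constructor
    · rintro ⟨_, ⟨a, rfl⟩, h⟩
      exact ⟨a, by rwa [← ih, joint_update_left]⟩
    · rintro ⟨a, h⟩
      exact ⟨{a}, ⟨a, rfl⟩, by rwa [← joint_update_left, ih]⟩
  | exSet k φ ih => simp only [lang, Sat, ← joint_update_right, ih]

/-! ### Free variables and sentences -/

/-- The list of the free variables. -/
def free : MonFormula → List ℕ
  | lt i j => [2 * i, 2 * j]
  | eq i j => [2 * i, 2 * j]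
  | mem i k => [2 * i, 2 * k + 1]
  | neg φ => φ.free
  | and φ ψ => φ.free ++ ψ.free
  | exInd i φ => φ.free.filter fun t => t != 2 * i
  | exSet k φ => φ.free.filter fun t => t != 2 * k + 1

theorem even_mem_free (φ : MonFormula) (i : ℕ) : 2 * i ∈ φ.free ↔ i ∈ φ.freeInd := by
  induction φ with
  | lt | eq => simp [free, freeInd]
  | mem j k => 
    simp only [free, freeInd, List.mem_cons, List.not_mem_nil, Finset.mem_singleton, or_false]
    omega
  | neg φ ih => exact ih
  | and φ ψ ih₁ ih₂ => simp [free, freeInd, ih₁, ih₂]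
  | exInd j φ ih => simp [free, freeInd, ih, and_comm]
  | exSet k φ ih =>
    have : 2 * i ≠ 2 * k + 1 := by omega
    simp [free, freeInd, ih, this]

theorem odd_mem_free (φ : MonFormula) (k : ℕ) : 2 * k + 1 ∈ φ.free ↔ k ∈ φ.freeSet := by
  induction φ with
  | lt | eq =>
    simp only [free, freeSet, List.mem_cons, List.not_mem_nil, Finset.notMem_empty,
      or_false, iff_false]
    omega
  | mem j k => 
    simp only [free, freeSet, List.mem_cons, List.not_mem_nil, Finset.mem_singleton, or_false]
    omega
  | neg φ ih => exact ih
  | and φ ψ ih₁ ih₂ => simp [free, freeSet, ih₁, ih₂]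
  | exInd j φ ih =>
    have : 2 * k + 1 ≠ 2 * j := by omega
    simp [free, freeSet, ih, this]
  | exSet j φ ih => simp [free, freeSet, ih, and_comm]

theorem isSentence_iff (φ : MonFormula) : φ.IsSentence ↔ φ.free = [] := by
  rw [IsSentence, Finset.eq_empty_iff_forall_notMem, Finset.eq_empty_iff_forall_notMem,
    List.eq_nil_iff_forall_not_mem]
  constructor
  · rintro ⟨h₁, h₂⟩ t ht
    obtain ⟨j, rfl | rfl⟩ := Nat.even_or_odd' t
    · exact h₁ j ((even_mem_free φ j).1 ht)
    · exact h₂ j ((odd_mem_free φ j).1 ht)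
  · exact fun h => ⟨fun i hi => h _ ((even_mem_free φ i).2 hi),
      fun k hk => h _ ((odd_mem_free φ k).2 hk)⟩

theorem update_congr {V W : ℕ → Set ℕ} {l : List ℕ} {k : ℕ}
    (h : ∀ t ∈ l.filter (fun t => t != k), V t = W t) (P : Set ℕ) :
    ∀ t ∈ l, Function.update V k P t = Function.update W k P t := fun t ht => by
  rcases eq_or_ne t k with rfl | hk
  · simp
  · simpa [hk] using h t (by simp [ht, hk])

theorem lang_congr (φ : MonFormula) {V W : ℕ → Set ℕ} (h : ∀ t ∈ φ.free, V t = W t) :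
    φ.lang V ↔ φ.lang W := by
  induction φ generalizing V W with
  | lt i j =>
    simp only [lang, exists_event_lt, h (2 * i) (by simp [free]), h (2 * j) (by simp [free])]
  | eq i j =>
    simp only [lang, exists_event_meet, h (2 * i) (by simp [free]), h (2 * j) (by simp [free])]
  | mem i k =>
    simp only [lang, exists_event_meet, h (2 * i) (by simp [free]), h (2 * k + 1) (by simp [free])]
  | neg φ ih => simp only [lang, ih h]
  | and φ ψ ih₁ ih₂ =>
    simp only [free, List.mem_append] at h
    simp only [lang, ih₁ fun t ht => h t (Or.inl ht), ih₂ fun t ht => h t (Or.inr ht)]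
  | exInd i φ ih =>
    simp only [lang, exists_event_lt, exists_event_meet, Function.update_self]
    exact exists_congr fun P => and_congr_right fun _ => ih (update_congr h P)
  | exSet k φ ih => exact exists_congr fun P => ih (update_congr h P)

/-- The empty-set word is no `joint` assignment, as individual variables would need singletons. For
a sentence this is harmless, since its language contains all words or none. -/
theorem mem_monadicTheory_iff (φ : MonFormula) :
    φ ∈ monadicTheory ℕ ↔ φ.free = [] ∧ φ.lang fun _ => ∅ := by
  rw [monadicTheory, Set.mem_ofPred_eq, isSentence_iff]
  refine and_congr_right fun h => ?_
  have hVW : ∀ V W, φ.lang V ↔ φ.lang W := fun V W => φ.lang_congr (by simp [h])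
  simp only [← lang_joint]
  exact ⟨fun H => (hVW _ _).1 (H (fun _ => 0) fun _ => ∅), fun H v V => (hVW _ _).1 H⟩

/-! ### The decision procedure -/

open Recognizer in
/-- The recognizer of the language of a formula, for letters with `K` binary digits. -/
def recognizer (K : ℕ) : MonFormula → Recognizer
  | lt i j => atom K 2 (2 * i) (2 * j)
  | eq i j => atom K 3 (2 * i) (2 * j)
  | mem i k => atom K 3 (2 * i) (2 * k + 1)
  | neg φ => compl K (φ.recognizer K)
  | and φ ψ => inter K (φ.recognizer K) (ψ.recognizer K)
  | exInd i φ => proj K (2 * i) (inter K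
      (inter K (atom K 3 (2 * i) (2 * i)) (compl K (atom K 2 (2 * i) (2 * i)))) (φ.recognizer K))
  | exSet k φ => proj K (2 * k + 1) (φ.recognizer K)

open Recognizer in
-- Every index `i` or `k` occurring in a formula is at most its code, so all the indices `2 * i` and
-- `2 * k + 1` are below `K`.
theorem recognizes_recognizer {K : ℕ} (φ : MonFormula) (h : 2 * φ.code + 1 < K) :
    Recognizes K (φ.recognizer K) φ.lang := by
  induction φ with
  | lt i j | eq i j | mem i j =>
    have h₁ := Nat.left_le_pair i j
    have h₂ := Nat.right_le_pair i j
    simp only [code] at h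
    exact recognizes_atom (by omega) (by omega) (by omega)
  | neg φ ih =>
    simp only [code] at h
    exact (ih (by omega)).compl
  | and φ ψ ih₁ ih₂ =>
    have h₁ := Nat.left_le_pair φ.code ψ.code
    have h₂ := Nat.right_le_pair φ.code ψ.code
    simp only [code] at h
    exact (ih₁ (by omega)).inter (ih₂ (by omega))
  | exInd i φ ih =>
    have h₁ := Nat.left_le_pair i φ.code
    have h₂ := Nat.right_le_pair i φ.code
    simp only [code] at h
    have hi : 2 * i < K := by omega
    exact (((recognizes_atom (by omega) hi hi).inter
      (recognizes_atom (by omega) hi hi).compl).inter (ih (by omega))).proj (2 * i)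
  | exSet k φ ih =>
    have h₂ := Nat.right_le_pair k φ.code
    simp only [code] at h
    exact (ih (by omega)).proj (2 * k + 1)

theorem primrec₂_recognizer : Primrec₂ recognizer := by
  have hK {β : Type} [Primcodable β] : Primrec fun p : ℕ × β => p.1 := Primrec.fst
  have hD {β : Type} [Primcodable β] : Primrec fun p : ℕ × β × Recognizer => p.2.2 :=
    Primrec.snd.comp Primrec.snd
  have h₁ {β : Type} [Primcodable β] : Primrec fun p : ℕ × ℕ × β => 2 * p.2.1 :=
    Primrec.nat_double.comp (Primrec.fst.comp Primrec.snd)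
  have h₁' {β : Type} [Primcodable β] : Primrec fun p : ℕ × ℕ × β => 2 * p.2.1 + 1 :=
    Primrec.nat_double_succ.comp (Primrec.fst.comp Primrec.snd)
  have h₂ : Primrec fun p : ℕ × ℕ × ℕ => 2 * p.2.2 :=
    Primrec.nat_double.comp (Primrec.snd.comp Primrec.snd)
  have h₂' : Primrec fun p : ℕ × ℕ × ℕ => 2 * p.2.2 + 1 :=
    Primrec.nat_double_succ.comp (Primrec.snd.comp Primrec.snd)
  have h₃ := Recognizer.primrec_inter hK
    (Recognizer.primrec_atom 3 hK (h₁ (β := Recognizer)) h₁)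
    (Recognizer.primrec_compl hK (Recognizer.primrec_atom 2 hK h₁ h₁))
  exact primrec₂_of_rec
    (flt := fun K i j => Recognizer.atom K 2 (2 * i) (2 * j))
    (feq := fun K i j => Recognizer.atom K 3 (2 * i) (2 * j))
    (fmem := fun K i k => Recognizer.atom K 3 (2 * i) (2 * k + 1))
    (fneg := Recognizer.compl) (fand := Recognizer.inter)
    (fexInd := fun K i D => Recognizer.proj K (2 * i) (Recognizer.inter K
      (Recognizer.inter K (Recognizer.atom K 3 (2 * i) (2 * i))
        (Recognizer.compl K (Recognizer.atom K 2 (2 * i) (2 * i)))) D))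
    (fexSet := fun K k D => Recognizer.proj K (2 * k + 1) D)
    (Recognizer.primrec_atom 2 hK h₁ h₂) (Recognizer.primrec_atom 3 hK h₁ h₂)
    (Recognizer.primrec_atom 3 hK h₁ h₂') (Recognizer.primrec_compl hK Primrec.snd)
    (Recognizer.primrec_inter hK (Primrec.fst.comp Primrec.snd) hD)
    (Recognizer.primrec_proj hK h₁ (Recognizer.primrec_inter hK h₃ hD))
    (Recognizer.primrec_proj hK h₁' hD)
    (fun _ _ _ => rfl) (fun _ _ _ => rfl) (fun _ _ _ => rfl) (fun _ _ => rfl) (fun _ _ _ => rfl)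
    (fun _ _ _ => rfl) (fun _ _ _ => rfl)

theorem primrec_free : Primrec free := by
  have hpair {f g : Unit × ℕ × ℕ → ℕ} (hf : Primrec f) (hg : Primrec g) :
      Primrec fun p => [f p, g p] :=
    Primrec.list_cons.comp hf (Primrec.list_cons.comp hg (Primrec.const []))
  have h₁ : Primrec fun p : Unit × ℕ × ℕ => 2 * p.2.1 :=
    Primrec.nat_double.comp (Primrec.fst.comp Primrec.snd)
  have h₂ : Primrec fun p : Unit × ℕ × ℕ => 2 * p.2.2 :=
    Primrec.nat_double.comp (Primrec.snd.comp Primrec.snd)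
  have h₂' : Primrec fun p : Unit × ℕ × ℕ => 2 * p.2.2 + 1 :=
    Primrec.nat_double_succ.comp (Primrec.snd.comp Primrec.snd)
  have hne : PrimrecRel fun t k : ℕ => t ≠ k := Primrec.eq.not
  have hfilter {f : ℕ → ℕ} (hf : Primrec f) :
      Primrec fun p : Unit × ℕ × List ℕ => p.2.2.filter fun t => t != f p.2.1 :=
    (hne.listFilter.comp (Primrec.snd.comp Primrec.snd)
      (hf.comp (Primrec.fst.comp Primrec.snd))).of_eq fun p => by
        congr 1
        funext t
        simp [bne, Bool.beq_eq_decide_eq]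
  have h : Primrec₂ fun (_ : Unit) (φ : MonFormula) => φ.free :=
    primrec₂_of_rec (fneg := fun _ l => l) (hpair h₁ h₂) (hpair h₁ h₂) (hpair h₁ h₂') Primrec.snd
      (Primrec.list_append.comp (Primrec.fst.comp Primrec.snd) (Primrec.snd.comp Primrec.snd))
      (hfilter Primrec.nat_double) (hfilter Primrec.nat_double_succ)
      (fun _ _ _ => rfl) (fun _ _ _ => rfl) (fun _ _ _ => rfl) (fun _ _ => rfl)
      (fun _ _ _ => rfl) (fun _ _ _ => rfl) (fun _ _ _ => rfl)
  exact h.comp (Primrec.const ()) Primrec.id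

/-- The recognizer of the language of `φ` for an alphabet that suffices for `φ`. -/
def canonicalRecognizer (φ : MonFormula) : Recognizer := φ.recognizer (2 * φ.code + 2)

theorem recognizes_canonicalRecognizer (φ : MonFormula) :
    Recognizer.Recognizes (2 * φ.code + 2) φ.canonicalRecognizer φ.lang :=
  φ.recognizes_recognizer (Nat.lt_succ_self _)

theorem primrec_canonicalRecognizer : Primrec canonicalRecognizer :=
  primrec₂_recognizer.comp
    (Primrec.succ.comp (Primrec.nat_double_succ.comp Primrec.encode)) Primrec.id

end MonFormula

open MonFormula Recognizer in
/-- The monadic theory of `(ω, <)` is decidable. -/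
theorem theorem3p4 : ComputablePred (fun φ : MonFormula => φ ∈ monadicTheory ℕ) := by
  let D := canonicalRecognizer
  have hD : Computable D := primrec_canonicalRecognizer.to_comp
  have hex : ∀ φ, ∃ n, (D φ).IsLinked n := fun φ =>
    φ.recognizes_canonicalRecognizer.exists_isLinked
  -- This unbounded search is the only step not shown to be primitive recursive.
  have hfind : Computable fun φ => Nat.find (hex φ) :=
    Computable.find (P := fun φ n => (D φ).IsLinked n)
      (PrimrecPred.computablePred (primrecPred_isLinked.comp
        (f := fun p : MonFormula × ℕ => (D p.1, p.2))
        (Primrec.pair (primrec_canonicalRecognizer.comp Primrec.fst) Primrec.snd))) hex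
  have htest : Primrec fun q : List ℕ × Recognizer × ℕ =>
      decide (q.1 = []) && q.2.1.acc (q.2.1.power q.2.2.unpair.1) (q.2.1.power q.2.2.unpair.2) := by
    have hE : Primrec fun q : List ℕ × Recognizer × ℕ => q.2.1 := Primrec.fst.comp Primrec.snd
    have hn : Primrec fun q : List ℕ × Recognizer × ℕ => q.2.2.unpair :=
      Primrec.unpair.comp (Primrec.snd.comp Primrec.snd)
    exact Primrec.and.comp (Primrec.eq.comp Primrec.fst (Primrec.const [])).decide
      (primrec_acc hE (primrec₂_power.comp hE (Primrec.fst.comp hn))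
        (primrec₂_power.comp hE (Primrec.snd.comp hn)))
  refine ComputablePred.computable_iff.2
    ⟨_, htest.to_comp.comp (primrec_free.to_comp.pair (hD.pair hfind)), ?_⟩
  funext φ
  rw [mem_monadicTheory_iff,
    φ.recognizes_canonicalRecognizer.empty_iff (Nat.find_spec (hex φ)), Bool.and_eq_true,
    decide_eq_true_iff]
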